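/- Let $d\in\mathbb N$ and let $H,J$ be complex Hilbert spaces. Let $\mathbb F^d$ be the free monoid on $d$ letters and $\mathbb B^d_{\mathbb N}=\bigsqcup_{n\ge 1}\mathbb B^d_n$ the non-commutative ball, where $\mathbb B^d_n$ is the set of $d$-tuples $Z=(Z_1,\dots,Z_d)$ of complex $n\times n$ matrices that are strict row contractions, $\|(Z_1\ \cdots\ Z_d)\|<1$. For a word $\alpha=i_1\cdots i_k$ put $Z^\alpha=Z_{i_1}\cdots Z_{i_k}$. For a Hilbert space $V$, identify $x=(x_\alpha)\in F^2_d\otimes V=\ell^2(\mathbb F^d)\otimes V$ with the free function $x(Z)=\sum_{\alpha}Z^\alpha\otimes x_\alpha$ on $\mathbb B^d_{\mathbb N}$. The left free shift acts by $(L_jf)(Z)=Z_jf(Z)$, $1\le j\le d$. Let $A\in\mathscr R_d(H,J)$, the right free Schur class: $A:F^2_d\otimes H\to F^2_d\otimes J$ is a linear contraction that acts as right multiplication by a free (intertwining-respecting) $\mathcal L(H,J)$-valued function $A^\dagger(Z)$ on $\mathbb B^d_{\mathbb N}$, the right product being determined by $(Z^\gamma\otimes h)\bullet(Z^\beta\otimes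 Y)=Z^{\gamma\beta}\otimes Yh$. For $h\in H$ write $Ah:=A(1\otimes h)$, i.e. $(Ah)(Z)=A^\dagger(Z)(I_n\otimes h)$. Let $\mathscr H^R(A)$ be the right free de Branges–Rovnyak space: the non-commutative reproducing kernel Hilbert space of $J$-valued functions on $\mathbb B^d_{\mathbb N}$ with kernel $$K^A(Z,W)[P]=K(Z,W)[P]\otimes I_J-(K(Z,W)\otimes \mathrm{id}_{\mathcal L(J)})\big[A^\dagger(Z)(P\otimes I_H)A^\dagger(W)^*\big],\qquad K(Z,W)[P]=\sum_{\alpha}Z^\alpha P(W^\alpha)^* ,$$ that is, the Hilbert space of functions generated by the vectors $K^A\{Z,y,v\}g$ ($Z\in\mathbb B^d_n$, $y,v\in\mathbb C^n$, $g\in J$) with $\langle K^A\{Z,y,v\}g,K^A\{W,x,u\}f\rangle=\langle y\otimes g,\,K^A(Z,W)[vu^*](x\otimes f)\rangle$ and $\langle K^A\{Z,y,v\}g,F\rangle=\langle y\otimes g,\,F(Z)v\rangle$ (inner products conjugate-linear in the first variable). For $1\le j\le d$ let $\mathbf A_j:H\to\mathscr H^R(A)$ be the bounded operator $\mathbf A_jh=(L_j^*\otimes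 I_J)A(1\otimes h)$ (the $j$-th component of the Gleason solution $(L^*\otimes I_J)A$ for $A$). Let $\hat A$ be the linear transformation $\hat Ah:=Ah\in\mathscr H^R(A)$ on the domain $\operatorname{Dom}(\hat A)=\{h\in H: Ah\in\mathscr H^R(A)\}$. Then: 1. For every $1\le j\le d$ and every $F\in\mathscr H^R(A)$: $L_jF\in\mathscr H^R(A)$ if and only if $\mathbf A_j^*F\in\operatorname{Dom}(\hat A)$. 2. If $Ah\in\mathscr H^R(A)$ for every $h\in H$, then $\mathscr H^R(A)$ is $L$-invariant, i.e. $L_jF\in\mathscr H^R(A)$ for every $1\le j\le d$ and every $F\in\mathscr H^R(A)$. -/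

import Mathlib

set_option linter.unusedSectionVars false
set_option linter.style.longLine false

noncomputable section

namespace FreeHardy

open scoped ComplexConjugate

/-- Words in the letters `0, …, d - 1`, i.e. elements of the free monoid; the unit is `[]`. -/
abbrev Word (d : ℕ) : Type := List (Fin d)

/-- The row `(Z_1, …, Z_d)` as an `n × (d n)` matrix, i.e. an operator `ℂ^n ⊗ ℂ^d → ℂ^n`. -/
def rowMatrix {d n : ℕ} (Z : Fin d → Matrix (Fin n) (Fin n) ℂ) :
    Matrix (Fin n) (Fin d × Fin n) ℂ :=
  Matrix.of fun a q => Z q.1 a q.2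

open scoped Matrix.Norms.L2Operator in
/-- Level `n` of the non-commutative open unit ball: strict row contractions on `ℂ^n`. -/
def NCBall (d n : ℕ) : Set (Fin d → Matrix (Fin n) (Fin n) ℂ) :=
  {Z | ‖rowMatrix Z‖ < 1}

/-- `Z^α = Z_{i_1} ⋯ Z_{i_k}` for `α = i_1 ⋯ i_k`. -/
def wordPow {d n : ℕ} (Z : Fin d → Matrix (Fin n) (Fin n) ℂ) (α : Word d) :
    Matrix (Fin n) (Fin n) ℂ :=
  (α.map Z).prod

open scoped Matrix.Norms.L2Operator in
lemma sum_vecMul_le {d n : ℕ} (Z : Fin d → Matrix (Fin n) (Fin n) ℂ) (w : Fin n → ℂ) :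
    ∑ i, ∑ b, ‖(Matrix.vecMul w (Z i)) b‖ ^ 2 ≤ ‖rowMatrix Z‖ ^ 2 * ∑ a, ‖w a‖ ^ 2 := by
  have h := Matrix.l2_opNorm_mulVec (rowMatrix Z).conjTranspose (WithLp.toLp 2 (star w))
  rw [Matrix.l2_opNorm_conjTranspose] at h
  have h2 := pow_le_pow_left₀ (norm_nonneg _) h 2
  rw [mul_pow, EuclideanSpace.norm_sq_eq, EuclideanSpace.norm_sq_eq, Fintype.sum_prod_type] at h2
  refine le_trans (le_of_eq ?_) (h2.trans (le_of_eq ?_))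
  · refine Finset.sum_congr rfl fun i _ => Finset.sum_congr rfl fun b _ => ?_
    have : (Matrix.mulVec (rowMatrix Z).conjTranspose (star w)) (i, b)
        = star (Matrix.vecMul w (Z i) b) := by
      simp [Matrix.mulVec, Matrix.vecMul, dotProduct, rowMatrix, mul_comm]
    change _ = ‖(Matrix.mulVec (rowMatrix Z).conjTranspose (star w)) (i, b)‖ ^ 2
    rw [this, norm_star]
  · simp

open scoped Matrix.Norms.L2Operator in
lemma sum_words_le {d n : ℕ} (Z : Fin d → Matrix (Fin n) (Fin n) ℂ) (k : ℕ) :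
    ∀ w : Fin n → ℂ, ∑ f : Fin k → Fin d,
      ∑ b, ‖(Matrix.vecMul w (wordPow Z (List.ofFn f))) b‖ ^ 2
        ≤ (‖rowMatrix Z‖ ^ 2) ^ k * ∑ a, ‖w a‖ ^ 2 := by
  induction k with
  | zero => intro w; simp [wordPow]
  | succ k ih =>
    intro w
    rw [← (Fin.consEquiv fun _ => Fin d).sum_comp, Fintype.sum_prod_type]
    have : ∀ (i : Fin d) (f : Fin k → Fin d),
        Matrix.vecMul w (wordPow Z (List.ofFn (Fin.consEquiv (fun _ => Fin d) (i, f))))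
          = Matrix.vecMul (Matrix.vecMul w (Z i)) (wordPow Z (List.ofFn f)) := by
      intro i f
      simp [wordPow, Fin.consEquiv, List.ofFn_succ, Matrix.vecMul_vecMul]
    simp_rw [this]
    calc _ ≤ ∑ i, (‖rowMatrix Z‖ ^ 2) ^ k * ∑ b, ‖(Matrix.vecMul w (Z i)) b‖ ^ 2 :=
          Finset.sum_le_sum fun i _ => ih _
      _ ≤ (‖rowMatrix Z‖ ^ 2) ^ k * (‖rowMatrix Z‖ ^ 2 * ∑ a, ‖w a‖ ^ 2) := by
          rw [← Finset.mul_sum]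
          gcongr
          exact sum_vecMul_le Z w
      _ = _ := by ring

open scoped Matrix.Norms.L2Operator in
lemma summable_wordPow {d n : ℕ} (Z : NCBall d n) (a b : Fin n) :
    Summable fun α : Word d => ‖wordPow Z.1 α a b‖ ^ 2 := by
  rw [← List.equivSigmaTuple.symm.summable_iff]
  have hr : ‖rowMatrix Z.1‖ ^ 2 < 1 := by
    have := Z.2
    simp only [NCBall, Set.mem_ofPred_eq] at this
    nlinarith [norm_nonneg (rowMatrix Z.1)]
  refine (summable_sigma_of_nonneg fun _ => by simp only [Function.comp]; positivity).2
    ⟨fun k => (hasSum_fintype _).summable, ?_⟩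
  refine Summable.of_nonneg_of_le (fun k => tsum_nonneg fun _ => by simp only [Function.comp]; positivity) (fun k => ?_)
    (summable_geometric_of_lt_one (by positivity) hr)
  rw [tsum_fintype]
  refine le_trans (Finset.sum_le_sum fun f _ => ?_)
    ((sum_words_le Z.1 k (Pi.single a 1)).trans_eq ?_)
  · refine le_trans ?_ (Finset.single_le_sum (f := fun b => ‖(Matrix.vecMul (Pi.single a 1)
      (wordPow Z.1 (List.ofFn f))) b‖ ^ 2) (fun _ _ => by positivity) (Finset.mem_univ b))
    simp [List.equivSigmaTuple]
  · rw [Finset.sum_eq_single a] <;> simp +contextual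


/-- Graded functions on the non-commutative ball with values in `V`: for `Z` at level `n`, `f(Z)` is
an `n × n` matrix over `V`, i.e. an element of `ℂ^{n × n} ⊗ V` (the level `n = 0` carries no
information). -/
abbrev NCFun (d : ℕ) (V : Type*) : Type _ := ∀ n : ℕ, NCBall d n → Matrix (Fin n) (Fin n) V

/-- A graded function on the ball is free (non-commutative) if it respects intertwinings:
`f(Z) X = X f(W)` whenever `Z_j X = X W_j` for all `j`. -/
def IsFree {d : ℕ} {V : Type*} [AddCommMonoid V] [Module ℂ V] (f : NCFun d V) : Prop :=
  ∀ (n m : ℕ) (Z : NCBall d n) (W : NCBall d m) (X : Matrix (Fin n) (Fin m) ℂ),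
    (∀ j, Z.1 j * X = X * W.1 j) →
      ∀ a b, ∑ c, X c b • f n Z a c = ∑ c, X a c • f m W c b

/-- The vector-valued full Fock space `F²_d ⊗ V`: square-summable families `x = ∑_α e_α ⊗ x_α`
of vectors of `V` indexed by words. -/
abbrev Fock (d : ℕ) (V : Type*) [NormedAddCommGroup V] : Type _ :=
  lp (fun _ : Word d => V) 2

variable {d : ℕ} {V : Type*} [NormedAddCommGroup V] [InnerProductSpace ℂ V]

/-- The identification of the Fock space with the free Hardy space of the ball:
`x ↦ (Z ↦ ∑_α Z^α ⊗ x_α)`. For complete `V` the series always converges, see `hasSum_eval`. -/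
def eval (x : Fock d V) : NCFun d V :=
  fun _ Z => Matrix.of fun a b => ∑' α, wordPow Z.1 α a b • x α

/-- The embedding `h ↦ 1 ⊗ h` of `V` as the constants of `F²_d ⊗ V`. -/
def vacuum (d : ℕ) (V : Type*) [NormedAddCommGroup V] [InnerProductSpace ℂ V] :
    V →L[ℂ] Fock d V :=
  lp.singleContinuousLinearMap ℂ (fun _ : Word d => V) 2 []

/-- Coefficients of `L_j x`: the coefficient at `j β` is `x_β`, all others vanish. -/
def prepend (j : Fin d) (x : Word d → V) : Word d → V
  | [] => 0
  | i :: β => if i = j then x β else 0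

lemma hasSum_of_eq {ι W : Type*} [AddCommMonoid W] [TopologicalSpace W] {f g : ι → W} {s : W}
    (h : ∀ i, f i = g i) (hg : HasSum g s) : HasSum f s :=
  (funext h : f = g) ▸ hg

lemma prepend_cons (j : Fin d) (x : Word d → V) (β : Word d) :
    prepend j x (j :: β) = x β := by simp [prepend]

lemma prepend_of_notMem (j : Fin d) (x : Word d → V) (α : Word d)
    (h : α ∉ Set.range (List.cons j)) : prepend j x α = 0 := by
  cases α with
  | nil => rfl
  | cons i β =>
    have : i ≠ j := by rintro rfl; exact h ⟨β, rfl⟩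
    simp [prepend, this]

lemma hasSum_prepend {W : Type*} [AddCommGroup W] [TopologicalSpace W] (j : Fin d)
    (x : Word d → V) (g : Word d → V → W) (hg : ∀ α, g α 0 = 0) (s : W) :
    HasSum (fun α => g α (prepend j x α)) s ↔ HasSum (fun β => g (j :: β) (x β)) s := by
  rw [← (List.cons_injective (a := j)).hasSum_iff (fun α h => by
    rw [prepend_of_notMem j x α h, hg])]
  simp [Function.comp_def, prepend_cons]

lemma hasSum_norm_sq (x : Fock d V) : HasSum (fun α => ‖x α‖ ^ 2) (‖x‖ ^ 2) := by
  have := lp.hasSum_norm (p := 2) (by simp) x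
  simpa using this

lemma memlp_two {c : Word d → V} (h : Summable fun α => ‖c α‖ ^ 2) :
    Memℓp c 2 := by
  refine memℓp_gen ?_
  simpa using h

/-- The left creation operator (left free shift) `L_j ⊗ I_V : e_β ⊗ v ↦ e_{jβ} ⊗ v`. -/
def creation (j : Fin d) : Fock d V →ₗᵢ[ℂ] Fock d V where
  toFun x := ⟨prepend j x, memlp_two
    ((hasSum_prepend j x (fun _ v => ‖v‖ ^ 2) (by simp) _).2 (hasSum_norm_sq x)).summable⟩
  map_add' x y := by
    ext α
    change prepend j (⇑x + ⇑y) α = prepend j x α + prepend j y α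
    cases α with
    | nil => simp [prepend]
    | cons i β => simp only [prepend, Pi.add_apply]; split_ifs <;> simp
  map_smul' c x := by
    ext α
    change prepend j (c • ⇑x) α = c • prepend j x α
    cases α with
    | nil => simp [prepend]
    | cons i β => simp [prepend]
  norm_map' x := by
    refine (sq_eq_sq₀ (norm_nonneg _) (norm_nonneg _)).1 ?_
    refine (hasSum_norm_sq _).unique ?_
    exact (hasSum_prepend j x (fun _ v => ‖v‖ ^ 2) (by simp) _).2 (hasSum_norm_sq x)

/-- Right multiplication (the right product) of an `H`-valued function by an
`L(H, J)`-valued one: `((Z^γ ⊗ h) ∙ (Z^β ⊗ Y)) = Z^{γβ} ⊗ Y h`. -/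
def rightMul {H J : Type*} [NormedAddCommGroup H] [InnerProductSpace ℂ H]
    [NormedAddCommGroup J] [InnerProductSpace ℂ J]
    (f : NCFun d H) (G : NCFun d (H →L[ℂ] J)) : NCFun d J :=
  fun n Z => Matrix.of fun a b => ∑ c, G n Z c b (f n Z a c)

/-- The right free Schur class: contractive right multipliers `A : F²_d ⊗ H → F²_d ⊗ J`,
`A = M^R_{A†(Z)}`, acting as right multiplication by a free `L(H, J)`-valued function `A†` on
the ball. The operator and the function determine each other. -/
structure RightSchur (d : ℕ) (H J : Type*) [NormedAddCommGroup H] [InnerProductSpace ℂ H]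
    [NormedAddCommGroup J] [InnerProductSpace ℂ J] where
  /-- the operator `A` -/
  op : Fock d H →L[ℂ] Fock d J
  /-- the free function `A†(Z)` -/
  dag : NCFun d (H →L[ℂ] J)
  isFree_dag : IsFree dag
  norm_op_le : ‖op‖ ≤ 1
  eval_op : ∀ x, eval (op x) = rightMul (eval x) dag

/-- The labels `Z, y, v` of the kernel vectors `K{Z, y, v}`: a point `Z` of the ball
at some level `n`, and `y, v ∈ ℂ^n`. -/
structure KernelPoint (d : ℕ) where
  n : ℕ
  Z : NCBall d n
  y : Fin n → ℂ
  v : Fin n → ℂ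

/-- `⟨y, Z^α v⟩`. -/
def KernelPoint.coef (p : KernelPoint d) (α : Word d) : ℂ :=
  ∑ a, ∑ b, conj (p.y a) * p.v b * wordPow p.Z.1 α a b

lemma summable_sq_sum {ι κ : Type*} (s : Finset κ) (f : κ → ι → ℂ)
    (h : ∀ k ∈ s, Summable fun i => ‖f k i‖ ^ 2) : Summable fun i => ‖∑ k ∈ s, f k i‖ ^ 2 := by
  refine Summable.of_nonneg_of_le (fun _ => by positivity) (fun i => ?_)
    ((summable_sum h).mul_left (s.card : ℝ))
  calc _ ≤ (∑ k ∈ s, ‖f k i‖) ^ 2 := by gcongr; exact norm_sum_le _ _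
    _ ≤ _ := sq_sum_le_card_mul_sum_sq

lemma KernelPoint.summable_coef (p : KernelPoint d) : Summable fun α => ‖p.coef α‖ ^ 2 := by
  refine summable_sq_sum _ _ fun a _ => summable_sq_sum _ _ fun b _ => ?_
  simp_rw [norm_mul, mul_pow]
  exact (summable_wordPow p.Z a b).mul_left _

lemma summable_smul [CompleteSpace V] {c : Word d → ℂ} (hc : Summable fun α => ‖c α‖ ^ 2)
    (x : Fock d V) : Summable fun α => c α • x α := by
  refine Summable.of_norm_bounded (g := fun α => ‖c α‖ ^ 2 + ‖x α‖ ^ 2)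
    (hc.add (hasSum_norm_sq x).summable) fun α => ?_
  rw [norm_smul]
  nlinarith [sq_nonneg (‖c α‖ - ‖x α‖), sq_nonneg (‖c α‖ + ‖x α‖)]

/-- The kernel vectors of the free Hardy space: `g ↦ K{Z, y, v} g`. -/
def KernelPoint.szegoVec (p : KernelPoint d) (V : Type*) [NormedAddCommGroup V] [InnerProductSpace ℂ V] :
    V →L[ℂ] Fock d V :=
  LinearMap.mkContinuous
    { toFun := fun g => ⟨fun α => conj (p.coef α) • g, memlp_two (by
        simp_rw [norm_smul, mul_pow, RCLike.norm_conj]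
        exact p.summable_coef.mul_right _)⟩
      map_add' := fun g h => by ext α; exact smul_add _ g h
      map_smul' := fun c g => by ext α; exact smul_comm _ c g }
    (Real.sqrt (∑' α, ‖p.coef α‖ ^ 2)) (fun g => by
      refine (sq_le_sq₀ (norm_nonneg _) (by positivity)).1 (le_of_eq ?_)
      rw [mul_pow, Real.sq_sqrt (tsum_nonneg fun _ => by positivity)]
      refine (hasSum_norm_sq _).unique ?_
      refine hasSum_of_eq (fun α => ?_) (p.summable_coef.hasSum.mul_right (‖g‖ ^ 2))
      change ‖conj (p.coef α) • g‖ ^ 2 = _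
      rw [norm_smul, mul_pow, RCLike.norm_conj])

lemma KernelPoint.szegoVec_apply (p : KernelPoint d) (g : V) (α : Word d) : p.szegoVec V g α = conj (p.coef α) • g := rfl

/-- `(y ⊗ I)^* M v`, so that `⟪g, p.pair M⟫ = ⟪y ⊗ g, M v⟫`. -/
def KernelPoint.pair {W : Type*} [AddCommMonoid W] [Module ℂ W] (p : KernelPoint d)
    (M : Matrix (Fin p.n) (Fin p.n) W) : W :=
  ∑ a, ∑ b, (conj (p.y a) * p.v b) • M a b

lemma hasSum_eval [CompleteSpace V] (x : Fock d V) {n : ℕ} (Z : NCBall d n) (a b : Fin n) :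
    HasSum (fun α => wordPow Z.1 α a b • x α) (eval x n Z a b) :=
  (summable_smul (summable_wordPow Z a b) x).hasSum

lemma KernelPoint.hasSum_pair_eval [CompleteSpace V] (p : KernelPoint d) (x : Fock d V) :
    HasSum (fun α => p.coef α • x α) (p.pair (eval x p.n p.Z)) := by
  have := hasSum_sum (s := Finset.univ) fun a (_ : a ∈ Finset.univ) =>
    hasSum_sum (s := Finset.univ) fun b (_ : b ∈ Finset.univ) =>
      (hasSum_eval x p.Z a b).const_smul (conj (p.y a) * p.v b)
  refine hasSum_of_eq (fun α => ?_) this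
  simp [KernelPoint.coef, Finset.sum_smul, smul_smul]

lemma KernelPoint.inner_szegoVec [CompleteSpace V] (p : KernelPoint d) (g : V) (x : Fock d V) :
    inner ℂ (p.szegoVec V g) x = inner ℂ g (p.pair (eval x p.n p.Z)) := by
  refine (lp.hasSum_inner (𝕜 := ℂ) (p.szegoVec V g) x).unique ?_
  refine hasSum_of_eq (fun α => ?_) ((innerSL ℂ g).hasSum (p.hasSum_pair_eval x))
  simp [szegoVec_apply, inner_smul_left]

lemma KernelPoint.adjoint_szegoVec [CompleteSpace V] (p : KernelPoint d) (x : Fock d V) :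
    (p.szegoVec V).adjoint x = p.pair (eval x p.n p.Z) := by
  refine ext_inner_left ℂ fun g => ?_
  rw [ContinuousLinearMap.adjoint_inner_right, inner_szegoVec]

lemma eval_creation (j : Fin d) [CompleteSpace V] (x : Fock d V) (n : ℕ) (Z : NCBall d n)
    (a b : Fin n) : eval (creation j x) n Z a b = ∑ c, Z.1 j a c • eval x n Z c b := by
  refine (hasSum_eval _ Z a b).unique ?_
  refine (hasSum_prepend j x (fun α v => wordPow Z.1 α a b • v) (by simp) _).2 ?_
  convert hasSum_sum (s := Finset.univ) fun c (_ : c ∈ Finset.univ) =>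
    (hasSum_eval x Z c b).const_smul (Z.1 j a c) using 2 with β
  simp [wordPow, Matrix.mul_apply, Finset.sum_smul, smul_smul]

lemma creation_single [DecidableEq (Word d)] (j : Fin d) (β : Word d) (g : V) :
    creation j (lp.single (E := fun _ : Word d => V) 2 β g) = lp.single (E := fun _ : Word d => V) 2 (j :: β) g := by
  ext α
  change prepend j (Pi.single β g) α = (Pi.single (j :: β) g : Word d → V) α
  cases α with
  | nil => simp [prepend]
  | cons i γ =>
    simp only [prepend, Pi.single_apply, List.cons.injEq]
    split_ifs <;> simp_all

lemma inner_single [DecidableEq (Word d)] (β : Word d) (g : V) (x : Fock d V) :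
    inner ℂ (lp.single (E := fun _ : Word d => V) 2 β g) x = inner ℂ g (x β) :=
  lp.inner_single_left (𝕜 := ℂ) β g x

lemma adjoint_creation [CompleteSpace V] (j : Fin d) (x : Fock d V) (β : Word d) :
    ((creation j).toContinuousLinearMap.adjoint x : Fock d V) β = x (j :: β) := by
  classical
  refine ext_inner_left ℂ fun g => ?_
  refine (inner_single β g _).symm.trans ?_
  rw [ContinuousLinearMap.adjoint_inner_right]
  change inner ℂ (creation j _) _ = _
  rw [creation_single]
  exact inner_single _ _ _

open scoped Matrix.Norms.L2Operator in
lemma exists_detect (α : Word d) : ∃ (n : ℕ) (Z : NCBall d n) (a b : Fin n) (c : ℂ), c ≠ 0 ∧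
    ∀ β, wordPow Z.1 β a b = if β = α then c else 0 := by
  let T : Fin d → Matrix (Fin (α.length + 1)) (Fin (α.length + 1)) ℂ := fun j =>
    Matrix.of fun a b => if b.1 = a.1 + 1 ∧ α[a.1]? = some j then 1 else 0
  let ε : ℂ := ((‖rowMatrix T‖ + 1)⁻¹ : ℝ)
  have hε : ε ≠ 0 := by
    simp only [ε, ne_eq, Complex.ofReal_eq_zero, inv_eq_zero]
    positivity
  let Z : Fin d → Matrix (Fin (α.length + 1)) (Fin (α.length + 1)) ℂ := fun j => ε • T j
  have hZ : Z ∈ NCBall d (α.length + 1) := by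
    have : rowMatrix Z = ε • rowMatrix T := by ext; simp [rowMatrix, Z]
    simp only [NCBall, Set.mem_ofPred_eq, this, norm_smul, ε, Complex.norm_real, norm_inv]
    rw [Real.norm_of_nonneg (by positivity), inv_mul_lt_iff₀ (by positivity)]
    linarith
  have key : ∀ (β : Word d) (a : Fin (α.length + 1)),
      wordPow Z β a (Fin.last _) = if β = α.drop a then ε ^ β.length else 0 := by
    intro β
    induction β with
    | nil =>
      intro a
      have h1 : (a = Fin.last α.length) ↔ ([] = List.drop a α) := by
        rw [eq_comm (a := []), List.drop_eq_nil_iff, Fin.ext_iff, Fin.val_last]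
        have := a.2
        omega
      simp only [wordPow, List.map_nil, List.prod_nil, Matrix.one_apply, List.length_nil, pow_zero,
        h1]
    | cons i β ih =>
      intro a
      have h0 : wordPow Z (i :: β) = Z i * wordPow Z β := by simp [wordPow]
      rw [h0, Matrix.mul_apply]
      simp_rw [ih]
      by_cases ha : a.1 < α.length
      · rw [Finset.sum_eq_single ⟨a.1 + 1, by omega⟩]
        · simp only [Z, T, Matrix.smul_apply, Matrix.of_apply, true_and, smul_eq_mul,
            List.getElem?_eq_getElem ha, Option.some.injEq, List.drop_eq_getElem_cons ha,
            List.cons.injEq, List.length_cons, pow_succ']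
          by_cases h1 : α[a.1] = i <;> by_cases h2 : β = List.drop (a.1 + 1) α <;>
            simp [h1, h2, eq_comm (a := i)]
        · intro b _ hb
          have : b.1 ≠ a.1 + 1 := fun h => hb (Fin.ext h)
          simp [Z, T, this]
        · simp
      · have h1 : α.drop a.1 = [] := List.drop_eq_nil_iff.2 (by omega)
        rw [h1, if_neg (by simp)]
        refine Finset.sum_eq_zero fun b _ => ?_
        have : b.1 ≠ a.1 + 1 := by have := b.2; omega
        simp [Z, T, this]
  refine ⟨_, ⟨Z, hZ⟩, 0, Fin.last _, ε ^ α.length, pow_ne_zero _ hε, fun β => ?_⟩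
  rw [key]
  by_cases h : β = α <;> simp [h]

lemma eval_injective [CompleteSpace V] : Function.Injective (eval : Fock d V → NCFun d V) := by
  intro x y h
  ext α
  obtain ⟨n, Z, a, b, c, hc, hZ⟩ := exists_detect α
  have hh : ∀ z : Fock d V, eval z n Z a b = c • z α := by
    intro z
    refine (hasSum_eval z Z a b).unique ?_
    convert hasSum_single α ?_ using 1
    · simp [hZ]
    · intro β hβ; simp [hZ, hβ]
  have := (hh x).symm.trans ((congrFun (congrFun (congrFun (congrFun h n) Z) a) b).trans (hh y))
  exact smul_right_injective V hc this


section Kernel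

/-- The ampliated free Szegő kernel `(K(Z, Y) ⊗ id)[Q] = ∑_α Z^α Q (Y^α)^*`, for a matrix `Q` with
entries in `W`; note `(Y^α)^* = (Y^*)^{α†}` with `α†` the reversed word. -/
def szegoMap {W : Type*} [NormedAddCommGroup W] [NormedSpace ℂ W] {n m : ℕ}
    (Z : NCBall d n) (Y : NCBall d m) (Q : Matrix (Fin n) (Fin m) W) :
    Matrix (Fin n) (Fin m) W :=
  Matrix.of fun a b => ∑' α : Word d, ∑ c, ∑ e,
    (wordPow Z.1 α a c * conj (wordPow Y.1 α b e)) • Q c e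

variable {H J : Type*} [NormedAddCommGroup H] [InnerProductSpace ℂ H] [CompleteSpace H]
  [NormedAddCommGroup J] [InnerProductSpace ℂ J] [CompleteSpace J]

/-- The right free de Branges-Rovnyak kernel
`K^A(Z, Y)[P] = K(Z, Y)[P] ⊗ I_J - (K(Z, Y) ⊗ I_J)[A†(Z) (P ⊗ I_H) A†(Y)^*]`. -/
def RightSchur.kernel (A : RightSchur d H J) {n m : ℕ} (Z : NCBall d n) (Y : NCBall d m)
    (P : Matrix (Fin n) (Fin m) ℂ) : Matrix (Fin n) (Fin m) (J →L[ℂ] J) :=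
  szegoMap Z Y (Matrix.of fun a b => P a b • ContinuousLinearMap.id ℂ J)
    - szegoMap Z Y (Matrix.of fun a b => ∑ c, ∑ e,
        P c e • (A.dag n Z a c ∘L (A.dag m Y b e).adjoint))

/-- The `L(J)`-valued Gram kernel of the kernel vectors `K^A{Z, y, v} g`:
`⟪K^A{Z,y,v} g, K^A{W,x,u} f⟫ = ⟪y ⊗ g, K^A(Z, W)[v u^*] (x ⊗ f)⟫`. -/
def RightSchur.kernelMatrix (A : RightSchur d H J) : Matrix (KernelPoint d) (KernelPoint d) (J →L[ℂ] J) :=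
  Matrix.of fun p q => ∑ a, ∑ b,
    (conj (p.y a) * q.y b) • A.kernel p.Z q.Z (Matrix.vecMulVec p.v (star q.v)) a b

lemma summable_szego {n m : ℕ} (Z : NCBall d n) (Y : NCBall d m) (a c : Fin n) (b e : Fin m) :
    Summable fun α : Word d => wordPow Z.1 α a c * conj (wordPow Y.1 α b e) := by
  refine Summable.of_norm_bounded (g := fun α => ‖wordPow Z.1 α a c‖ ^ 2 + ‖wordPow Y.1 α b e‖ ^ 2)
    ((summable_wordPow Z a c).add (summable_wordPow Y b e)) fun α => ?_
  rw [norm_mul, RCLike.norm_conj]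
  nlinarith [sq_nonneg (‖wordPow Z.1 α a c‖ - ‖wordPow Y.1 α b e‖),
    sq_nonneg (‖wordPow Z.1 α a c‖ + ‖wordPow Y.1 α b e‖)]

lemma szegoMap_apply {W : Type*} [NormedAddCommGroup W] [NormedSpace ℂ W] {n m : ℕ}
    (Z : NCBall d n) (Y : NCBall d m) (Q : Matrix (Fin n) (Fin m) W) (a : Fin n) (b : Fin m) :
    szegoMap Z Y Q a b = ∑ c, ∑ e,
      (∑' α : Word d, wordPow Z.1 α a c * conj (wordPow Y.1 α b e)) • Q c e :=
  (hasSum_sum fun c _ => hasSum_sum fun e _ =>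
    (summable_szego Z Y a c b e).hasSum.smul_const (Q c e)).tsum_eq

/-- Gram coefficients of the free Szegő kernel. -/
def KernelPoint.gram (p q : KernelPoint d) (c : Fin p.n) (e : Fin q.n) : ℂ :=
  ∑ a, ∑ b, (conj (p.y a) * q.y b) *
    ∑' α : Word d, wordPow p.Z.1 α a c * conj (wordPow q.Z.1 α b e)

/-- The point with `v` replaced by a standard basis vector. -/
def KernelPoint.col (p : KernelPoint d) (c : Fin p.n) : KernelPoint d := ⟨p.n, p.Z, p.y, Pi.single c 1⟩

lemma KernelPoint.coef_col (p : KernelPoint d) (c : Fin p.n) (α : Word d) :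
    (p.col c).coef α = ∑ a, conj (p.y a) * wordPow p.Z.1 α a c := by
  simp [KernelPoint.coef, KernelPoint.col, Pi.single_apply]
  exact if_pos (Finset.mem_univ c)

lemma KernelPoint.inner_szegoVec_col (p q : KernelPoint d) (c : Fin p.n) (e : Fin q.n) (g f : V) :
    inner ℂ ((p.col c).szegoVec V g) ((q.col e).szegoVec V f) = p.gram q c e * inner ℂ g f := by
  refine (lp.hasSum_inner (𝕜 := ℂ) ((p.col c).szegoVec V g) ((q.col e).szegoVec V f)).unique ?_
  refine hasSum_of_eq (fun α => ?_) ((hasSum_sum (s := Finset.univ) fun a _ =>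
    hasSum_sum (s := Finset.univ) fun b _ =>
    (summable_szego p.Z q.Z a c b e).hasSum.mul_left (conj (p.y a) * q.y b)).mul_right _)
  rw [szegoVec_apply, szegoVec_apply, inner_smul_left, inner_smul_right, coef_col, coef_col, ← mul_assoc]
  congr 1
  simp only [map_sum, map_mul, RCLike.conj_conj, Finset.sum_mul_sum]
  refine Finset.sum_congr rfl fun a _ => Finset.sum_congr rfl fun b _ => ?_
  ring

lemma KernelPoint.szegoVec_eq_sum (p : KernelPoint d) (g : V) :
    p.szegoVec V g = ∑ c, (p.col c).szegoVec V (conj (p.v c) • g) := by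
  ext α
  rw [lp.coeFn_sum, Finset.sum_apply]
  simp only [szegoVec_apply, smul_smul, ← Finset.sum_smul, ← map_mul, ← map_sum, coef_col]
  congr 2
  simp only [KernelPoint.coef, Finset.sum_mul]
  rw [Finset.sum_comm]
  refine Finset.sum_congr rfl fun a _ => Finset.sum_congr rfl fun b _ => ?_
  ring

/-- The `c`-th block of the column `A†(Z) v`. -/
def RightSchur.dagv (A : RightSchur d H J) (p : KernelPoint d) (c : Fin p.n) : H →L[ℂ] J :=
  ∑ b, p.v b • A.dag p.n p.Z c b

lemma KernelPoint.pair_col {W : Type*} [AddCommMonoid W] [Module ℂ W] (p : KernelPoint d) (c : Fin p.n)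
    (M : Matrix (Fin p.n) (Fin p.n) W) : (p.col c).pair M = ∑ a, conj (p.y a) • M a c := by
  refine Finset.sum_congr rfl fun a _ => ?_
  refine (Finset.sum_eq_single c (fun b _ hb => ?_) (fun h => absurd (Finset.mem_univ c) h)).trans ?_
  · simp [KernelPoint.col, hb]
  · simp [KernelPoint.col]

lemma RightSchur.adjoint_op_szegoVec (A : RightSchur d H J) (p : KernelPoint d) (g : J) :
    A.op.adjoint (p.szegoVec J g) = ∑ c, (p.col c).szegoVec H ((A.dagv p c).adjoint g) := by
  refine ext_inner_right ℂ fun x => ?_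
  rw [ContinuousLinearMap.adjoint_inner_left, KernelPoint.inner_szegoVec, A.eval_op, sum_inner]
  simp_rw [KernelPoint.inner_szegoVec, ContinuousLinearMap.adjoint_inner_left, ← inner_sum]
  congr 1
  have : ∀ c, (p.col c).pair (eval x (p.col c).n (p.col c).Z)
      = ∑ a, conj (p.y a) • eval x p.n p.Z a c := fun c => p.pair_col c _
  simp_rw [this]
  simp only [KernelPoint.pair, rightMul, dagv, Matrix.of_apply, sum_apply, smul_apply, map_sum, map_smul,
    Finset.smul_sum, smul_smul]
  rw [Finset.sum_congr rfl fun a _ => Finset.sum_comm, Finset.sum_comm]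

lemma sum_swap4 {α β γ δ W : Type*} [Fintype α] [Fintype β] [Fintype γ] [Fintype δ]
    [AddCommMonoid W] (F : α → β → γ → δ → W) :
    ∑ a, ∑ b, ∑ c, ∑ e, F a b c e = ∑ c, ∑ e, ∑ a, ∑ b, F a b c e := by
  have h := Finset.sum_comm (s := (Finset.univ : Finset (α × β)))
    (t := (Finset.univ : Finset (γ × δ))) (f := fun p q => F p.1 p.2 q.1 q.2)
  simpa only [Fintype.sum_prod_type] using h

lemma RightSchur.kernelMatrix_apply (A : RightSchur d H J) (p q : KernelPoint d) :
    A.kernelMatrix p q = ∑ c, ∑ e, p.gram q c e •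
      ((p.v c * conj (q.v e)) • ContinuousLinearMap.id ℂ J
        - A.dagv p c ∘L (A.dagv q e).adjoint) := by
  have h : ∀ c e, A.dagv p c ∘L (A.dagv q e).adjoint = ∑ b, ∑ b',
      (p.v b * conj (q.v b')) • (A.dag p.n p.Z c b ∘L (A.dag q.n q.Z e b').adjoint) := by
    intro c e
    ext f
    simp only [dagv, map_sum, LinearIsometryEquiv.map_smulₛₗ, ContinuousLinearMap.comp_apply,
      sum_apply, smul_apply, map_smul, Finset.smul_sum, smul_smul]
    rw [Finset.sum_comm]
    simp only [mul_comm]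
  have h2 : ∀ a b, A.kernel p.Z q.Z (Matrix.vecMulVec p.v (star q.v)) a b = ∑ c, ∑ e,
      (∑' α : Word d, wordPow p.Z.1 α a c * conj (wordPow q.Z.1 α b e)) •
        ((p.v c * conj (q.v e)) • ContinuousLinearMap.id ℂ J
          - A.dagv p c ∘L (A.dagv q e).adjoint) := by
    intro a b
    simp_rw [h, smul_sub, Finset.sum_sub_distrib]
    rw [kernel, Matrix.sub_apply, szegoMap_apply, szegoMap_apply]
    rfl
  simp only [kernelMatrix, Matrix.of_apply, h2, KernelPoint.gram, Finset.sum_smul, Finset.smul_sum,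
    mul_smul]
  exact sum_swap4 _

/-- `I - A A^*`. -/
def RightSchur.defect (A : RightSchur d H J) : Fock d J →L[ℂ] Fock d J :=
  ContinuousLinearMap.id ℂ _ - A.op ∘L A.op.adjoint

lemma RightSchur.inner_defect_eq (A : RightSchur d H J) (x y : Fock d J) :
    inner ℂ x (A.defect y) = inner ℂ x y - inner ℂ (A.op.adjoint x) (A.op.adjoint y) := by
  rw [defect, sub_apply, inner_sub_right, ContinuousLinearMap.adjoint_inner_left]
  rfl

lemma RightSchur.inner_kernelMatrix (A : RightSchur d H J) (p q : KernelPoint d) (g f : J) :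
    inner ℂ g (A.kernelMatrix p q f) = inner ℂ (p.szegoVec J g) (A.defect (q.szegoVec J f)) := by
  have e1 : inner ℂ (p.szegoVec J g) (q.szegoVec J f) = ∑ c, ∑ e, p.gram q c e *
      ((p.v c * conj (q.v e)) * inner ℂ g f) := by
    rw [p.szegoVec_eq_sum, q.szegoVec_eq_sum, sum_inner]
    refine Finset.sum_congr rfl fun c _ => ?_
    rw [inner_sum]
    refine Finset.sum_congr rfl fun e _ => ?_
    rw [KernelPoint.inner_szegoVec_col, inner_smul_left, inner_smul_right, RCLike.conj_conj]
    ring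
  have e2 : inner ℂ (A.op.adjoint (p.szegoVec J g)) (A.op.adjoint (q.szegoVec J f)) = ∑ c, ∑ e,
      p.gram q c e * inner ℂ g (A.dagv p c ((A.dagv q e).adjoint f)) := by
    rw [A.adjoint_op_szegoVec, A.adjoint_op_szegoVec, sum_inner]
    refine Finset.sum_congr rfl fun c _ => ?_
    rw [inner_sum]
    refine Finset.sum_congr rfl fun e _ => ?_
    rw [KernelPoint.inner_szegoVec_col, ContinuousLinearMap.adjoint_inner_left]
  rw [A.inner_defect_eq, e1, e2, A.kernelMatrix_apply]
  simp only [inner_sum, sum_apply, smul_apply, sub_apply, inner_smul_right, inner_sub_right,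
    ← Finset.sum_sub_distrib, ContinuousLinearMap.comp_apply, ContinuousLinearMap.id_apply, mul_sub]

lemma RightSchur.norm_sq_le (A : RightSchur d H J) (x : Fock d J) :
    ‖A.op.adjoint x‖ ^ 2 ≤ ‖x‖ ^ 2 := by
  have h := A.op.adjoint.le_opNorm x
  have h2 : ‖A.op.adjoint‖ ≤ 1 := by
    rw [LinearIsometryEquiv.norm_map]; exact A.norm_op_le
  have : ‖A.op.adjoint x‖ ≤ ‖x‖ := by nlinarith [norm_nonneg x]
  gcongr

lemma RightSchur.inner_defect (A : RightSchur d H J) (x : Fock d J) :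
    RCLike.re (inner ℂ x (A.defect x)) = ‖x‖ ^ 2 - ‖A.op.adjoint x‖ ^ 2 := by
  rw [inner_defect_eq, map_sub, inner_self_eq_norm_sq, inner_self_eq_norm_sq]

lemma RightSchur.adjoint_defect (A : RightSchur d H J) : A.defect.adjoint = A.defect := by
  rw [defect, map_sub, ContinuousLinearMap.adjoint_comp, ContinuousLinearMap.adjoint_adjoint]
  congr 1
  exact ContinuousLinearMap.adjoint_id

lemma RightSchur.inner_kernelMatrix_left (A : RightSchur d H J) (p q : KernelPoint d) (g f : J) :
    inner ℂ (A.kernelMatrix q p g) f = inner ℂ g (A.kernelMatrix p q f) := by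
  rw [← inner_conj_symm, A.inner_kernelMatrix, A.inner_kernelMatrix, inner_conj_symm,
    ← ContinuousLinearMap.adjoint_inner_right, A.adjoint_defect]

lemma RightSchur.posSemidef (A : RightSchur d H J) : A.kernelMatrix.PosSemidef := by
  have t := (RKHS.posSemidef_tfae (K := A.kernelMatrix)).out 0 2
  rw [t]
  refine ⟨?_, fun w => ?_⟩
  · change A.kernelMatrix.conjTranspose = A.kernelMatrix
    funext p q
    refine ContinuousLinearMap.ext fun f => ?_
    refine ext_inner_left ℂ fun g => ?_
    rw [Matrix.conjTranspose_apply, ContinuousLinearMap.star_eq_adjoint,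
      ContinuousLinearMap.adjoint_inner_right, A.inner_kernelMatrix_left]
  · have : w.sum (fun x v => w.sum fun x' v' => inner ℂ (A.kernelMatrix x' x v) v')
        = inner ℂ (w.sum fun (p : KernelPoint d) (g : J) => p.szegoVec J g)
          (A.defect (w.sum fun (p : KernelPoint d) (g : J) => p.szegoVec J g)) := by
      simp only [Finsupp.sum, map_sum, sum_inner, inner_sum, A.inner_kernelMatrix_left,
        A.inner_kernelMatrix]
      exact Finset.sum_comm
    rw [this, A.inner_defect]
    linarith [A.norm_sq_le (w.sum fun (p : KernelPoint d) (g : J) => p.szegoVec J g)]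

instance (A : RightSchur d H J) : Fact A.kernelMatrix.PosSemidef := ⟨A.posSemidef⟩

/-- The right free de Branges-Rovnyak space `ℋ^R(A)`: the reproducing kernel Hilbert space with
kernel `K^A`, i.e. the completion of the span of the vectors `K^A{Z, y, v} g`. -/
abbrev HR (A : RightSchur d H J) : Type _ := RKHS.OfKernel A.kernelMatrix

/-- An element `F` of `ℋ^R(A)` as a `J`-valued function on the ball: the `(a, b)` entry of `F(Z)`
is the evaluation of `F` against `K^A{Z, e_a, e_b}`. -/
def HR.toNC {A : RightSchur d H J} (F : HR A) : NCFun d J :=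
  fun n Z => Matrix.of fun a b => F ⟨n, Z, Pi.single a 1, Pi.single b 1⟩


open RKHS in
lemma inner_kerFun_kerFun (A : RightSchur d H J) (p q : KernelPoint d) (g f : J) :
    inner ℂ (kerFun (HR A) p g) (kerFun (HR A) q f)
      = inner ℂ (p.szegoVec J g) (A.defect (q.szegoVec J f)) := by
  rw [kerFun_inner, kerFun_apply, OfKernel.kernel_ofKernel, A.inner_kernelMatrix]

lemma KernelPoint.szegoVec_eq_sum_single (p : KernelPoint d) (g : J) :
    p.szegoVec J g = ∑ a, ∑ b, (p.y a * conj (p.v b)) •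
      (⟨p.n, p.Z, Pi.single a 1, Pi.single b 1⟩ : KernelPoint d).szegoVec J g := by
  ext α
  simp only [lp.coeFn_sum, Finset.sum_apply, lp.coeFn_smul, Pi.smul_apply, szegoVec_apply, smul_smul,
    ← Finset.sum_smul]
  congr 1
  simp only [KernelPoint.coef, map_sum, map_mul, RCLike.conj_conj]
  refine Finset.sum_congr rfl fun a _ => Finset.sum_congr rfl fun b _ => ?_
  rw [Finset.sum_eq_single a, Finset.sum_eq_single b] <;> simp +contextual

lemma HR.apply_eq {A : RightSchur d H J} (F : HR A) (p : KernelPoint d) :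
    F p = p.pair (F.toNC p.n p.Z) := by
  have hk : ∀ g, RKHS.kerFun (HR A) p g = ∑ a, ∑ b, (p.y a * conj (p.v b)) •
      RKHS.kerFun (HR A) (⟨p.n, p.Z, Pi.single a 1, Pi.single b 1⟩ : KernelPoint d) g := by
    intro g
    refine RKHS.ext fun q => ?_
    refine ext_inner_left ℂ fun f => ?_
    rw [← RKHS.kerFun_inner, ← RKHS.kerFun_inner, inner_kerFun_kerFun, p.szegoVec_eq_sum_single]
    simp only [inner_sum, inner_smul_right, map_sum, map_smul, inner_kerFun_kerFun]
  refine ext_inner_left ℂ fun g => ?_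
  rw [← RKHS.kerFun_inner, hk]
  simp only [sum_inner, inner_smul_left, RKHS.kerFun_inner, KernelPoint.pair, inner_sum, inner_smul_right,
    map_mul, RCLike.conj_conj, HR.toNC, Matrix.of_apply]

lemma HR.toNC_injective (A : RightSchur d H J) :
    Function.Injective (HR.toNC : HR A → NCFun d J) := by
  intro F G h
  refine RKHS.ext fun p => ?_
  rw [F.apply_eq, G.apply_eq, h]

lemma KernelPoint.pair_single {W : Type*} [AddCommMonoid W] [Module ℂ W] {n : ℕ} (Z : NCBall d n)
    (a b : Fin n) (M : Matrix (Fin n) (Fin n) W) :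
    (⟨n, Z, Pi.single a 1, Pi.single b 1⟩ : KernelPoint d).pair M = M a b := by
  unfold KernelPoint.pair
  dsimp only
  rw [Finset.sum_eq_single a, Finset.sum_eq_single b] <;> simp +contextual

lemma op_creation (A : RightSchur d H J) (j : Fin d) (x : Fock d H) :
    A.op (creation j x) = creation j (A.op x) := by
  refine eval_injective ?_
  rw [A.eval_op]
  funext n Z
  ext a b
  rw [eval_creation, A.eval_op]
  simp only [rightMul, Matrix.of_apply, eval_creation, map_sum, map_smul, Finset.smul_sum]
  rw [Finset.sum_comm]

lemma vacuum_creation_le (j : Fin d) (y : Fock d H) :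
    ‖(vacuum d H).adjoint y‖ ^ 2 + ‖(creation j).toContinuousLinearMap.adjoint y‖ ^ 2
      ≤ ‖y‖ ^ 2 := by
  classical
  set h := (vacuum d H).adjoint y
  set z := (creation j).toContinuousLinearMap.adjoint y
  have h1 : inner ℂ (vacuum d H h) (creation j z) = 0 := by
    refine (inner_single [] h (creation j z)).trans ?_
    exact inner_zero_right _
  have h2 : ‖vacuum d H h + creation j z‖ ^ 2 = ‖h‖ ^ 2 + ‖z‖ ^ 2 := by
    rw [@norm_add_sq ℂ, h1]
    have : ‖vacuum d H h‖ = ‖h‖ := lp.norm_single (by simp) _ _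
    simp [this]
  have h3 : RCLike.re (inner ℂ y (vacuum d H h + creation j z)) = ‖h‖ ^ 2 + ‖z‖ ^ 2 := by
    rw [inner_add_right, ← ContinuousLinearMap.adjoint_inner_left]
    have : inner ℂ y (creation j z) = inner ℂ z z :=
      (ContinuousLinearMap.adjoint_inner_left (creation j).toContinuousLinearMap z y).symm
    rw [this, map_add, inner_self_eq_norm_sq, inner_self_eq_norm_sq]
  have h4 := @norm_sub_sq ℂ _ _ _ _ y (vacuum d H h + creation j z)
  nlinarith [sq_nonneg ‖y - (vacuum d H h + creation j z)‖]

lemma exists_gleason (A : RightSchur d H J) (j : Fin d) :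
    ∃ T : H →L[ℂ] HR A, ∀ h, (T h).toNC =
      eval ((creation j).toContinuousLinearMap.adjoint (A.op (vacuum d H h))) := by
  let S : Fock d J →L[ℂ] H :=
    (vacuum d H).adjoint ∘L A.op.adjoint ∘L (creation j).toContinuousLinearMap
  have hS : ∀ x, ‖S x‖ ^ 2 ≤ RCLike.re (inner ℂ x (A.defect x)) := by
    intro x
    have e : (creation j).toContinuousLinearMap.adjoint (A.op.adjoint (creation j x))
        = A.op.adjoint x := by
      refine ext_inner_right ℂ fun z => ?_
      rw [ContinuousLinearMap.adjoint_inner_left, ContinuousLinearMap.adjoint_inner_left,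
        ContinuousLinearMap.adjoint_inner_left]
      change inner ℂ (creation j x) (A.op (creation j z)) = _
      rw [op_creation, LinearIsometry.inner_map_map]
    have h1 := vacuum_creation_le j (A.op.adjoint (creation j x))
    have h2 := A.norm_sq_le (creation j x)
    rw [e] at h1
    rw [LinearIsometry.norm_map] at h2
    rw [A.inner_defect]
    change ‖(vacuum d H).adjoint (A.op.adjoint (creation j x))‖ ^ 2 ≤ _
    linarith
  let φ : (KernelPoint d →₀ J) →ₗ[ℂ] HR A :=
    Finsupp.lsum ℂ fun p => (RKHS.kerFun (HR A) p).toLinearMap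
  let T : (KernelPoint d →₀ J) →ₗ[ℂ] Fock d J := Finsupp.lsum ℂ fun p => (p.szegoVec J).toLinearMap
  have hφ : ∀ w, inner ℂ (φ w) (φ w) = inner ℂ (T w) (A.defect (T w)) := by
    intro w
    simp only [φ, T, Finsupp.lsum_apply, Finsupp.sum, map_sum, sum_inner, inner_sum,
      ContinuousLinearMap.coe_coe, inner_kerFun_kerFun]
  have hb : ∀ w, ‖(S.toLinearMap ∘ₗ T) w‖ ≤ 1 * ‖φ w‖ := by
    intro w
    rw [one_mul]
    refine (sq_le_sq₀ (norm_nonneg _) (norm_nonneg _)).1 ?_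
    rw [← inner_self_eq_norm_sq (𝕜 := ℂ) (φ w), hφ]
    exact hS (T w)
  have hd : DenseRange φ := by
    have h1 := RKHS.kerFun_dense (HR A)
    have h2 : Submodule.span ℂ {x | ∃ p v, RKHS.kerFun (HR A) p v = x} ≤ LinearMap.range φ := by
      rw [Submodule.span_le]
      rintro _ ⟨p, v, rfl⟩
      exact ⟨Finsupp.single p v, by simp [φ]⟩
    have h3 : (LinearMap.range φ).topologicalClosure = ⊤ :=
      top_le_iff.1 (h1 ▸ Submodule.topologicalClosure_mono h2)
    exact (Submodule.dense_iff_topologicalClosure_eq_top.2 h3)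
  refine ⟨((S.toLinearMap ∘ₗ T).extendOfNorm φ).adjoint, fun h => ?_⟩
  funext n Z
  ext a b
  let p : KernelPoint d := ⟨n, Z, Pi.single a 1, Pi.single b 1⟩
  refine Eq.trans ?_ (KernelPoint.pair_single Z a b _)
  refine ext_inner_left ℂ fun g => ?_
  rw [← KernelPoint.inner_szegoVec]
  change inner ℂ g ((((S.toLinearMap ∘ₗ T).extendOfNorm φ).adjoint h : HR A) p) = _
  rw [← RKHS.kerFun_inner, ContinuousLinearMap.adjoint_inner_right]
  have e1 : RKHS.kerFun (HR A) p g = φ (Finsupp.single p g) := by simp [φ]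
  rw [e1, LinearMap.extendOfNorm_eq hd ⟨1, hb⟩]
  have e2 : (S.toLinearMap ∘ₗ T) (Finsupp.single p g) = S (p.szegoVec J g) := by simp [T]
  rw [e2]
  change inner ℂ ((vacuum d H).adjoint (A.op.adjoint (creation j (p.szegoVec J g)))) h = _
  rw [ContinuousLinearMap.adjoint_inner_left, ContinuousLinearMap.adjoint_inner_left,
    ContinuousLinearMap.adjoint_inner_right]
  rfl

/-- The component `𝐀_j = (L_j^* ⊗ I_J) A : H → ℋ^R(A)` of the Gleason solution of `A`: it is the
bounded operator with `(𝐀_j h)(Z) = (L_j^* A (1 ⊗ h))(Z)`, see `gleason_spec`. -/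
def gleason (A : RightSchur d H J) (j : Fin d) : H →L[ℂ] HR A :=
  Classical.choose (exists_gleason A j)

lemma gleason_spec (A : RightSchur d H J) (j : Fin d) (h : H) : (gleason A j h).toNC =
    eval ((creation j).toContinuousLinearMap.adjoint (A.op (vacuum d H h))) :=
  Classical.choose_spec (exists_gleason A j) h

/-- The function `(A h)(Z) = A†(Z) h`. -/
def RightSchur.applyVec (A : RightSchur d H J) (h : H) : NCFun d J :=
  fun n Z => Matrix.of fun a b => A.dag n Z a b h

/-- The left shift on functions: `(L_j f)(Z) = Z_j f(Z)`. -/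
def leftShift (j : Fin d) (f : NCFun d J) : NCFun d J :=
  fun n Z => Matrix.of fun a b => ∑ c, Z.1 j a c • f n Z c b

/-- The function `f` on the ball belongs to `ℋ^R(A)`. -/
def MemHR (A : RightSchur d H J) (f : NCFun d J) : Prop := ∃ F : HR A, F.toNC = f

lemma HR.toNC_add {A : RightSchur d H J} (F G : HR A) :
    (F + G).toNC = fun n Z => F.toNC n Z + G.toNC n Z := by
  funext n Z; ext a b; simp [HR.toNC]

lemma HR.toNC_smul {A : RightSchur d H J} (c : ℂ) (F : HR A) :
    (c • F).toNC = fun n Z => c • F.toNC n Z := by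
  funext n Z; ext a b; simp [HR.toNC]

lemma RightSchur.applyVec_add (A : RightSchur d H J) (h k : H) :
    A.applyVec (h + k) = fun n Z => A.applyVec h n Z + A.applyVec k n Z := by
  funext n Z; ext a b; simp [RightSchur.applyVec]

lemma RightSchur.applyVec_smul (A : RightSchur d H J) (c : ℂ) (h : H) :
    A.applyVec (c • h) = fun n Z => c • A.applyVec h n Z := by
  funext n Z; ext a b; simp [RightSchur.applyVec]

/-- The linear transformation `Â h = A h ∈ ℋ^R(A)` on the domain
`𝓓_A = {h ∈ H | A h ∈ ℋ^R(A)}`. -/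
def Ahat (A : RightSchur d H J) : H →ₗ.[ℂ] HR A where
  domain :=
    { carrier := {h | MemHR A (A.applyVec h)}
      zero_mem' := ⟨0, by funext n Z; ext a b; simp [HR.toNC, RightSchur.applyVec]⟩
      add_mem' := by
        rintro h k ⟨F, hF⟩ ⟨G, hG⟩
        exact ⟨F + G, by rw [HR.toNC_add, hF, hG, A.applyVec_add]⟩
      smul_mem' := by
        rintro c h ⟨F, hF⟩
        exact ⟨c • F, by rw [HR.toNC_smul, hF, A.applyVec_smul]⟩ }
  toFun :=
    { toFun := fun h => Classical.choose h.2
      map_add' := fun h k => HR.toNC_injective A (by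
        rw [HR.toNC_add, Classical.choose_spec h.2, Classical.choose_spec k.2,
          Classical.choose_spec (h + k).2]
        exact A.applyVec_add h k)
      map_smul' := fun c h => HR.toNC_injective A (by
        rw [RingHom.id_apply, HR.toNC_smul, Classical.choose_spec h.2,
          Classical.choose_spec (c • h).2]
        exact A.applyVec_smul c h) }

end Kernel

end FreeHardy

end

noncomputable section

namespace FreeHardy

open scoped ComplexConjugate
open ContinuousLinearMap (adjoint)

variable {d : ℕ} {V : Type*} [NormedAddCommGroup V] [InnerProductSpace ℂ V]
variable {H J : Type*} [NormedAddCommGroup H] [InnerProductSpace ℂ H] [CompleteSpace H]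
  [NormedAddCommGroup J] [InnerProductSpace ℂ J] [CompleteSpace J]

/-! Write `Γ` for `kerMap A`, the contraction `F²_d ⊗ J → ℋ^R(A)` taking Szegő kernel vectors to
kernel vectors of `K^A`. By the reproducing property, `Γ^*` realises each `F` as the Fock vector
defining the same function. Since `eval` is injective, a function given by a Fock vector lies in
`ℋ^R(A)` exactly when the vector lies in the range of `Γ^*`. The Gram kernel of `K^A` is that of `I
- A A^*`, whence `Γ^* Γ = I - A A^*` (`adjoint_kerMap_kerMap`).

A right multiplier commutes with the left shift, `A L_j = L_j A`. Its commutation with `L_j^*` fails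
only on the vacuum: `L_j^* A - A L_j^* = (L_j^* A) P_vac`. Two facts follow. The inequality `‖Γ L_j
x‖ ≤ ‖Γ x‖` gives a contraction `T_j` of `ℋ^R(A)` with `T_j Γ = Γ L_j` (`compressedShift`). The
vacuum defect, combined with `Γ^* 𝐀_j h = L_j^* A (1 ⊗ h)`, gives `L_j Γ^* F = Γ^* T_j F + A (1 ⊗
𝐀_j^* F)`, first on the dense range of `Γ` (`creation_defect`), then everywhere
(`creation_adjoint_kerMap`).

The first summand always lies in the range of `Γ^*`, so `L_j F` belongs to `ℋ^R(A)` if and only if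
`A (1 ⊗ 𝐀_j^* F)` does, which is the condition `𝐀_j^* F ∈ Dom(Â)`. -/

/-! ### Kernel vectors and the inclusion of `ℋ^R(A)` into the Fock space. -/

/-- Finite sums of Szegő kernel vectors. -/
def szegoSum (d : ℕ) (V : Type*) [NormedAddCommGroup V] [InnerProductSpace ℂ V] :
    (KernelPoint d →₀ V) →ₗ[ℂ] Fock d V :=
  Finsupp.lsum ℂ fun p => (p.szegoVec V).toLinearMap

/-- Finite sums of kernel vectors of `ℋ^R(A)`. -/
def kerSum (A : RightSchur d H J) : (KernelPoint d →₀ J) →ₗ[ℂ] HR A :=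
  Finsupp.lsum ℂ fun p => (RKHS.kerFun (HR A) p).toLinearMap

lemma szegoSum_single (p : KernelPoint d) (g : V) :
    szegoSum d V (Finsupp.single p g) = p.szegoVec V g := by simp [szegoSum]

lemma kerSum_single (A : RightSchur d H J) (p : KernelPoint d) (g : J) :
    kerSum A (Finsupp.single p g) = RKHS.kerFun (HR A) p g := by simp [kerSum]

lemma eval_zero : eval (0 : Fock d V) = fun _ _ => 0 := by
  funext n Z
  ext a b
  simp [eval]

/-- A vector of the Fock space orthogonal to all Szegő kernel vectors vanishes. -/
lemma eq_zero_of_inner_szegoVec [CompleteSpace V] (x : Fock d V)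
    (h : ∀ (p : KernelPoint d) (g : V), inner ℂ (p.szegoVec V g) x = 0) : x = 0 := by
  refine eval_injective ?_
  rw [eval_zero]
  funext n Z
  ext a b
  refine (KernelPoint.pair_single Z a b _).symm.trans ?_
  refine ext_inner_left ℂ fun g => ?_
  refine (KernelPoint.inner_szegoVec _ g x).symm.trans ?_
  rw [h]
  exact (inner_zero_right _).symm

lemma denseRange_szegoSum [CompleteSpace V] : DenseRange (szegoSum d V) := by
  have : (LinearMap.range (szegoSum d V)).topologicalClosure = ⊤ := by
    rw [Submodule.topologicalClosure_eq_top_iff, Submodule.eq_bot_iff]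
    intro x hx
    refine eq_zero_of_inner_szegoVec x fun p g => ?_
    exact (Submodule.mem_orthogonal _ _).1 hx _ ⟨Finsupp.single p g, szegoSum_single p g⟩
  exact Submodule.dense_iff_topologicalClosure_eq_top.2 this

lemma denseRange_kerSum (A : RightSchur d H J) : DenseRange (kerSum A) := by
  have h2 : Submodule.span ℂ {x | ∃ p v, RKHS.kerFun (HR A) p v = x} ≤
      LinearMap.range (kerSum A) := by
    rw [Submodule.span_le]
    rintro _ ⟨p, v, rfl⟩
    exact ⟨Finsupp.single p v, kerSum_single A p v⟩
  have h3 : (LinearMap.range (kerSum A)).topologicalClosure = ⊤ :=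
    top_le_iff.1 (RKHS.kerFun_dense (HR A) ▸ Submodule.topologicalClosure_mono h2)
  exact Submodule.dense_iff_topologicalClosure_eq_top.2 h3

lemma inner_kerSum (A : RightSchur d H J) (w : KernelPoint d →₀ J) :
    inner ℂ (kerSum A w) (kerSum A w) = inner ℂ (szegoSum d J w) (A.defect (szegoSum d J w)) := by
  simp only [kerSum, szegoSum, Finsupp.lsum_apply, Finsupp.sum, map_sum, sum_inner, inner_sum,
    ContinuousLinearMap.coe_coe, inner_kerFun_kerFun]

/-- The squared norm on the left is the quadratic form of `I - A A^*` at the Szegő sum, and `A A^* ≥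
0`. -/
lemma norm_kerSum_le (A : RightSchur d H J) (w : KernelPoint d →₀ J) :
    ‖kerSum A w‖ ≤ 1 * ‖szegoSum d J w‖ := by
  rw [one_mul]
  refine (sq_le_sq₀ (norm_nonneg _) (norm_nonneg _)).1 ?_
  rw [← inner_self_eq_norm_sq (𝕜 := ℂ) (kerSum A w), inner_kerSum, A.inner_defect]
  linarith [sq_nonneg ‖A.op.adjoint (szegoSum d J w)‖]

/-- The contraction `F²_d ⊗ J → ℋ^R(A)` taking Szegő kernel vectors to the kernel vectors of
`ℋ^R(A)`; its adjoint is the inclusion of `ℋ^R(A)` into the Fock space. -/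
def kerMap (A : RightSchur d H J) : Fock d J →L[ℂ] HR A :=
  (kerSum A).extendOfNorm (szegoSum d J)

/-- The norm bound makes the extension consistent: Szegő kernel vectors may be linearly dependent,
but a vanishing combination of them has a vanishing image. -/
lemma kerMap_szegoSum (A : RightSchur d H J) (w : KernelPoint d →₀ J) :
    kerMap A (szegoSum d J w) = kerSum A w :=
  LinearMap.extendOfNorm_eq denseRange_szegoSum ⟨1, norm_kerSum_le A⟩ w

lemma kerMap_szegoVec (A : RightSchur d H J) (p : KernelPoint d) (g : J) :
    kerMap A (p.szegoVec J g) = RKHS.kerFun (HR A) p g := by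
  rw [← szegoSum_single, kerMap_szegoSum, kerSum_single]

lemma denseRange_kerMap (A : RightSchur d H J) : DenseRange (kerMap A) := by
  refine (denseRange_kerSum A).mono ?_
  rintro _ ⟨w, rfl⟩
  exact ⟨szegoSum d J w, kerMap_szegoSum A w⟩

/-- Both sides are read off by the reproducing property, from Szegő vectors on the left and from
their images under `kerMap A` on the right. -/
lemma eval_adjoint_kerMap (A : RightSchur d H J) (F : HR A) :
    eval (adjoint (kerMap A) F) = F.toNC := by
  funext n Z
  ext a b
  refine (KernelPoint.pair_single Z a b _).symm.trans ?_
  refine ext_inner_left ℂ fun g => ?_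
  refine (KernelPoint.inner_szegoVec ⟨n, Z, Pi.single a 1, Pi.single b 1⟩ g _).symm.trans ?_
  rw [ContinuousLinearMap.adjoint_inner_right, kerMap_szegoVec, RKHS.kerFun_inner]
  rfl

/-- Turns membership into a condition on a submodule of the Fock space, where summands already known
to belong can be dropped. -/
lemma memHR_eval_iff (A : RightSchur d H J) (x : Fock d J) :
    MemHR A (eval x) ↔ x ∈ LinearMap.range (adjoint (kerMap A)).toLinearMap := by
  constructor
  · rintro ⟨F, hF⟩
    exact ⟨F, eval_injective ((eval_adjoint_kerMap A F).trans hF)⟩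
  · rintro ⟨F, rfl⟩
    exact ⟨F, (eval_adjoint_kerMap A F).symm⟩

/-- Both operators are bounded and have the same matrix elements between Szegő kernel vectors, which
span a dense subspace; the matrix elements are the Gram kernel of `K^A`. -/
lemma adjoint_kerMap_kerMap (A : RightSchur d H J) (x : Fock d J) :
    adjoint (kerMap A) (kerMap A x) = A.defect x := by
  suffices h : adjoint (kerMap A) ∘L kerMap A = A.defect from DFunLike.congr_fun h x
  refine ContinuousLinearMap.coeFn_injective
    (denseRange_szegoSum.equalizer (by fun_prop) (by fun_prop) ?_)
  funext w
  change adjoint (kerMap A) (kerMap A (szegoSum d J w)) = A.defect (szegoSum d J w)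
  induction w using Finsupp.induction_linear with
  | zero => simp
  | add v w hv hw => simp only [map_add, hv, hw]
  | single q f =>
    rw [szegoSum_single, ← sub_eq_zero]
    refine eq_zero_of_inner_szegoVec _ fun p g => ?_
    rw [inner_sub_right, ContinuousLinearMap.adjoint_inner_right, kerMap_szegoVec,
      kerMap_szegoVec, inner_kerFun_kerFun, sub_self]

lemma norm_kerMap_sq (A : RightSchur d H J) (x : Fock d J) :
    ‖kerMap A x‖ ^ 2 = ‖x‖ ^ 2 - ‖adjoint A.op x‖ ^ 2 := by
  rw [← A.inner_defect, ← adjoint_kerMap_kerMap, ContinuousLinearMap.adjoint_inner_right,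
    inner_self_eq_norm_sq]

/-! ### The left shift and its compression to `ℋ^R(A)`. -/

lemma adjoint_creation_creation [CompleteSpace V] (j : Fin d) (x : Fock d V) :
    adjoint (creation j).toContinuousLinearMap (creation j x) = x := by
  ext β
  rw [adjoint_creation]
  exact prepend_cons j x β

lemma adjoint_creation_adjoint_op (A : RightSchur d H J) (j : Fin d) (x : Fock d J) :
    adjoint (creation j).toContinuousLinearMap (adjoint A.op x)
      = adjoint A.op (adjoint (creation j).toContinuousLinearMap x) := by
  refine ext_inner_right ℂ fun z => ?_
  simp only [ContinuousLinearMap.adjoint_inner_left]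
  change inner ℂ x (A.op (creation j z)) = inner ℂ x (creation j (A.op z))
  rw [op_creation]

/-- By `norm_kerMap_sq` and the isometry of `L_j`, the claim is `‖A^* x‖ ≤ ‖A^* L_j x‖`. It holds
because `L_j^* A^* L_j x = A^* L_j^* L_j x = A^* x` and `L_j^*` is a contraction. -/
lemma norm_kerMap_creation_le (A : RightSchur d H J) (j : Fin d) (x : Fock d J) :
    ‖kerMap A (creation j x)‖ ≤ 1 * ‖kerMap A x‖ := by
  rw [one_mul]
  refine (sq_le_sq₀ (norm_nonneg _) (norm_nonneg _)).1 ?_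
  rw [norm_kerMap_sq, norm_kerMap_sq, LinearIsometry.norm_map]
  -- Only the `L_j^*` component is needed; the vacuum component is discarded as nonnegative.
  have h := vacuum_creation_le j (adjoint A.op (creation j x))
  rw [adjoint_creation_adjoint_op, adjoint_creation_creation] at h
  linarith [sq_nonneg ‖adjoint (vacuum d H) (adjoint A.op (creation j x))‖]

/-- The contraction of `ℋ^R(A)` intertwined by `kerMap A` with the left free shift; it is the
adjoint of the restricted backward shift. -/
def compressedShift (A : RightSchur d H J) (j : Fin d) : HR A →L[ℂ] HR A :=
  ((kerMap A).toLinearMap ∘ₗ (creation j).toLinearMap).extendOfNorm (kerMap A).toLinearMap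

lemma compressedShift_kerMap (A : RightSchur d H J) (j : Fin d) (x : Fock d J) :
    compressedShift A j (kerMap A x) = kerMap A (creation j x) :=
  LinearMap.extendOfNorm_eq (e := (kerMap A).toLinearMap) (denseRange_kerMap A)
    ⟨1, norm_kerMap_creation_le A j⟩ x

/-! ### The vacuum decomposition and the failure of `I - A A^*` to commute with the shift. -/

lemma vacuum_apply_nil (h : V) : vacuum d V h [] = h := by
  classical
  exact lp.single_apply_self (E := fun _ : Word d => V) 2 [] h

lemma vacuum_apply_cons (h : V) (i : Fin d) (β : Word d) : vacuum d V h (i :: β) = 0 := by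
  classical
  exact lp.single_apply_ne (E := fun _ : Word d => V) 2 [] h (by simp)

lemma adjoint_vacuum [CompleteSpace V] (x : Fock d V) : adjoint (vacuum d V) x = x [] := by
  classical
  refine ext_inner_left ℂ fun g => ?_
  rw [ContinuousLinearMap.adjoint_inner_right]
  exact inner_single [] g x

lemma creation_apply_cons (i j : Fin d) (x : Fock d V) (β : Word d) :
    creation j x (i :: β) = if i = j then x β else 0 := rfl

lemma creation_apply_nil (j : Fin d) (x : Fock d V) : creation j x [] = 0 := rfl

/-- `I = P_vac + ∑_k L_k L_k^*`. -/
lemma vacuum_add_sum_creation [CompleteSpace V] (x : Fock d V) :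
    x = vacuum d V (adjoint (vacuum d V) x)
      + ∑ k, creation k (adjoint (creation k).toContinuousLinearMap x) := by
  ext α
  rw [lp.coeFn_add, Pi.add_apply, lp.coeFn_sum, Finset.sum_apply]
  cases α with
  | nil => simp [vacuum_apply_nil, adjoint_vacuum, creation_apply_nil]
  | cons i β => simp [vacuum_apply_cons, creation_apply_cons, adjoint_creation]

lemma adjoint_creation_creation_of_ne [CompleteSpace V] {j k : Fin d} (h : j ≠ k) (x : Fock d V) :
    adjoint (creation j).toContinuousLinearMap (creation k x) = 0 := by
  ext β
  rw [adjoint_creation, creation_apply_cons, if_neg h]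
  rfl

/-- `L_j^* A = (L_j^* A) P_vac + A L_j^*`. -/
lemma adjoint_creation_op (A : RightSchur d H J) (j : Fin d) (x : Fock d H) :
    adjoint (creation j).toContinuousLinearMap (A.op x)
      = adjoint (creation j).toContinuousLinearMap
          (A.op (vacuum d H (adjoint (vacuum d H) x)))
        + A.op (adjoint (creation j).toContinuousLinearMap x) := by
  conv_lhs => rw [vacuum_add_sum_creation x]
  simp only [map_add, map_sum, op_creation]
  congr 1
  -- The creation operators have mutually orthogonal ranges, so `L_j^*` retains only the `j`-th
  -- term.
  rw [Finset.sum_eq_single j]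
  · rw [adjoint_creation_creation]
  · exact fun k _ hk => adjoint_creation_creation_of_ne hk.symm _
  · simp

/-- Read by adjunction, this computes `𝐀_j^*` on the range of `Γ`: `𝐀_j^* Γ x` is the vacuum
coefficient of `A^* L_j x`. -/
lemma adjoint_kerMap_gleason (A : RightSchur d H J) (j : Fin d) (h : H) :
    adjoint (kerMap A) (gleason A j h)
      = adjoint (creation j).toContinuousLinearMap (A.op (vacuum d H h)) :=
  eval_injective ((eval_adjoint_kerMap A _).trans (gleason_spec A j h))

/-- `L_j^*` passes through `A^*` freely but through `A` only up to the vacuum term of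
`adjoint_creation_op`. Applied to `A^* x`, that term is the Gleason component. -/
lemma adjoint_creation_defect (A : RightSchur d H J) (j : Fin d) (x : Fock d J) :
    adjoint (creation j).toContinuousLinearMap (A.defect x)
      = A.defect (adjoint (creation j).toContinuousLinearMap x)
        - adjoint (kerMap A) (gleason A j (adjoint (vacuum d H) (adjoint A.op x))) := by
  have e : ∀ y, A.defect y = y - A.op (adjoint A.op y) := fun _ => rfl
  rw [e, e, map_sub, adjoint_creation_op, adjoint_creation_adjoint_op, adjoint_kerMap_gleason]
  abel

/-- The adjoint form of `adjoint_creation_defect`, using that `I - A A^*` is self-adjoint. It is the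
shift formula for `F = Γ x`. -/
lemma creation_defect (A : RightSchur d H J) (j : Fin d) (x : Fock d J) :
    creation j (A.defect x) = A.defect (creation j x)
      + A.op (vacuum d H (adjoint (gleason A j) (kerMap A x))) := by
  have hD : ∀ y z, inner ℂ y (A.defect z) = inner ℂ (A.defect y) z := fun y z => by
    rw [← ContinuousLinearMap.adjoint_inner_right, A.adjoint_defect]
  have hL : ∀ y z : Fock d J, inner ℂ y (creation j z)
      = inner ℂ (adjoint (creation j).toContinuousLinearMap y) z := fun y z =>
    (ContinuousLinearMap.adjoint_inner_left (creation j).toContinuousLinearMap z y).symm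
  refine ext_inner_left ℂ fun y => ?_
  rw [inner_add_right, hL, hD, hD, hL, adjoint_creation_defect, inner_sub_left,
    ContinuousLinearMap.adjoint_inner_left (kerMap A),
    ← ContinuousLinearMap.adjoint_inner_left A.op,
    ← ContinuousLinearMap.adjoint_inner_left (vacuum d H),
    ContinuousLinearMap.adjoint_inner_right (gleason A j)]
  abel

/-- `L_j F = T_j F + A 𝐀_j^* F` for `F ∈ ℋ^R(A)`, with `T_j` the compressed shift. -/
lemma creation_adjoint_kerMap (A : RightSchur d H J) (j : Fin d) (F : HR A) :
    creation j (adjoint (kerMap A) F) = adjoint (kerMap A) (compressedShift A j F)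
      + A.op (vacuum d H (adjoint (gleason A j) F)) := by
  -- Both sides are continuous in `F`, so it suffices to take `F = Γ x`, where `Γ^* Γ = I - A A^*`
  -- reduces the claim to `creation_defect`.
  have h := (denseRange_kerMap A).equalizer
    (g := fun F => creation j (adjoint (kerMap A) F))
    (h := fun F => adjoint (kerMap A) (compressedShift A j F)
      + A.op (vacuum d H (adjoint (gleason A j) F)))
    ((creation j).continuous.comp (adjoint (kerMap A)).continuous) (by fun_prop) (by
      funext x
      simp only [Function.comp_apply]
      rw [compressedShift_kerMap, adjoint_kerMap_kerMap, adjoint_kerMap_kerMap, creation_defect])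
  exact congrFun h F

/-! ### Return to functions on the ball and the invariance criterion. -/

lemma eval_vacuum (h : V) (n : ℕ) (Z : NCBall d n) (a b : Fin n) :
    eval (vacuum d V h) n Z a b = if a = b then h else 0 := by
  have e : eval (vacuum d V h) n Z a b = wordPow Z.1 [] a b • vacuum d V h [] :=
    tsum_eq_single [] fun α hα => by
      cases α with
      | nil => exact absurd rfl hα
      | cons i β => rw [vacuum_apply_cons, smul_zero]
  rw [e, vacuum_apply_nil]
  simp [wordPow, Matrix.one_apply]

lemma eval_op_vacuum (A : RightSchur d H J) (h : H) :
    eval (A.op (vacuum d H h)) = A.applyVec h := by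
  rw [A.eval_op]
  funext n Z
  ext a b
  simp only [rightMul, Matrix.of_apply, eval_vacuum, RightSchur.applyVec]
  -- The function of `1 ⊗ h` is `I_n ⊗ h`, so only the diagonal term of the matrix product survives.
  rw [Finset.sum_eq_single a] <;> simp +contextual [eq_comm]

lemma leftShift_toNC (A : RightSchur d H J) (j : Fin d) (F : HR A) :
    leftShift j F.toNC = eval (creation j (adjoint (kerMap A) F)) := by
  funext n Z
  ext a b
  rw [eval_creation, eval_adjoint_kerMap]
  rfl

lemma memHR_leftShift_iff (A : RightSchur d H J) (j : Fin d) (F : HR A) :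
    MemHR A (leftShift j F.toNC) ↔ adjoint (gleason A j) F ∈ (Ahat A).domain := by
  change _ ↔ MemHR A (A.applyVec (adjoint (gleason A j) F))
  rw [leftShift_toNC, ← eval_op_vacuum, memHR_eval_iff, memHR_eval_iff, creation_adjoint_kerMap]
  -- The summand `Γ^* T_j F` lies in the range of `Γ^*` for every `F`, so only `A (1 ⊗ 𝐀_j^* F)`
  -- decides membership.
  exact Submodule.add_mem_iff_right _ ⟨_, rfl⟩

end FreeHardy

end

theorem corollary5p9 {d : ℕ} {H J : Type*}
    [NormedAddCommGroup H] [InnerProductSpace ℂ H] [CompleteSpace H]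
    [NormedAddCommGroup J] [InnerProductSpace ℂ J] [CompleteSpace J]
    (A : FreeHardy.RightSchur d H J) :
    (∀ (j : Fin d) (F : FreeHardy.HR A),
      FreeHardy.MemHR A (FreeHardy.leftShift j F.toNC) ↔
        ContinuousLinearMap.adjoint (FreeHardy.gleason A j) F ∈ (FreeHardy.Ahat A).domain) ∧
    ((∀ h : H, FreeHardy.MemHR A (A.applyVec h)) →
      ∀ (j : Fin d) (F : FreeHardy.HR A),
        FreeHardy.MemHR A (FreeHardy.leftShift j F.toNC)) :=
  -- In the second part the domain of `Â` is all of `H`, so the criterion holds for every `F`.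
  ⟨FreeHardy.memHR_leftShift_iff A, fun h j F => (FreeHardy.memHR_leftShift_iff A j F).2 (h _)⟩
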